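/- Let $K,N\ge 2$ be integers. In the $(K,N,M)$ device-to-device private caching system with a trusted server, where $M\in[N/K,N]$, the library consists of $N$ independent files $F_1,\dots,F_N$, each of $B$ i.i.d. uniform bits, and there are $K$ users with demand vector $\mathbf D=(D_1,\dots,D_K)\in[N]^K$, independent of the library. A scheme consists of the following, all variables having finite alphabets. - Placement: random cache metadata $(\mathscr M(C_1),\dots,\mathscr M(C_K))$, independent of the library and of the demands, and caches $Z_k=(\mathscr M(C_k),C_k)$, where $C_k$ is a deterministic function of $\mathscr M(C_k)$ and $F_1,\dots,F_N$. - Delivery: the trusted server, which has no access to the library, draws queries $(\mathscr M(P_1),\dots,\mathscr M(P_K))$ at random with a law that depends only on $\mathbf D$ and the cache metadata; user $k$ then broadcasts $X_k=(\mathscr M(P_k),P_k)$, where $P_k$ is a deterministic function of $\mathscr M(P_k)$ and $Z_k$. Write $\mathbf X=(X_1,\dots,X_K)$. A load $R$ is achievable with memory $M$ if there are $\epsilon_B\ge 0$ with $\epsilon_B\to 0$ as $B\to\infty$ such that for every sufficiently large $B$ there is a scheme for which, for every law of the demand vector $\mathbf D$ and with entropies in bits, $$H(Z_k)\le B(M+\epsilon_B),\qquad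 H(F_{D_k}\mid \mathbf X,Z_k,D_k)\le B\epsilon_B,\qquad I(\mathbf D;\mathbf X,Z_k\mid D_k)=0\qquad\text{for all }k\in[K],$$ $$\sum_{k\in[K]}H(X_k)\le B(R+\epsilon_B).$$ Let $R^\star=R^\star(M)$ be the infimum of the achievable loads, and let $U=(K-1)N$. **Theorem.** For every $M\in[N/K,N]$, the value at $M$ of the lower convex envelope of the points $$\left(\frac{N+t-1}{K},\ \frac{\binom Ut-\binom{U-N}t}{\binom U{t-1}}\right),\qquad t\in\{1,\dots,U+1\},$$ is an achievable load; in particular $R^\star$ is at most this value. -/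

import Mathlib

open Filter Topology

noncomputable section

namespace D2DCaching

/-! ### Shannon information measures (in bits) of finitely-valued random variables -/

/-- Shannon entropy `H(X)` in bits of the finitely-valued random variable `X` on `(Ω, P)`. -/
def entropy {Ω α : Type} [Fintype α] (P : PMF Ω) (X : Ω → α) : ℝ :=
  ∑ a, Real.negMulLog ((P.map X) a).toReal / Real.log 2

/-- Conditional entropy `H(X | Y) = H(X, Y) - H(Y)`. -/
def condEntropy {Ω α β : Type} [Fintype α] [Fintype β]
    (P : PMF Ω) (X : Ω → α) (Y : Ω → β) : ℝ :=
  entropy P (fun ω => (X ω, Y ω)) - entropy P Y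

/-- Conditional mutual information `I(X ; Y | Z) = H(X | Z) - H(X | Y, Z)`. -/
def condMutualInfo {Ω α β γ : Type} [Fintype α] [Fintype β] [Fintype γ]
    (P : PMF Ω) (X : Ω → α) (Y : Ω → β) (Z : Ω → γ) : ℝ :=
  condEntropy P X Z - condEntropy P X (fun ω => (Y ω, Z ω))

/-! ### Device-to-device private caching with a trusted server -/

/-- A library of `N` files of `B` bits each. -/
abbrev Library (N B : ℕ) : Type := Fin N → Fin B → Bool

/-- A demand vector: user `k` demands the file with index `d k`. -/
abbrev Demands (K N : ℕ) : Type := Fin K → Fin N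

/-- A two-phase caching scheme with a trusted server, for `K` users and `N` files of `B` bits.

* The cache metadata `(𝓜(C_1), …, 𝓜(C_K))` is drawn from `placement`, without knowledge of the
  demands and independently of the library.
* `C_k` is a deterministic function of the metadata `𝓜(C_k)` and of the library.
* The trusted server, which knows the demands and all cache metadata but has no access to the
  library, draws the queries `(𝓜(P_1), …, 𝓜(P_K))` from `query`.
* `P_k` is a deterministic function of the query `𝓜(P_k)` and of `Z_k = (𝓜(C_k), C_k)`.

All alphabets are finite. -/
structure Scheme (K N B : ℕ) where
  CacheMeta : Fin K → Type
  CacheContent : Fin K → Type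
  PacketMeta : Fin K → Type
  Packet : Fin K → Type
  [fintypeCacheMeta : ∀ k, Fintype (CacheMeta k)]
  [fintypeCacheContent : ∀ k, Fintype (CacheContent k)]
  [fintypePacketMeta : ∀ k, Fintype (PacketMeta k)]
  [fintypePacket : ∀ k, Fintype (Packet k)]
  placement : PMF (∀ k, CacheMeta k)
  cache : ∀ k, CacheMeta k → Library N B → CacheContent k
  query : Demands K N → (∀ k, CacheMeta k) → PMF (∀ k, PacketMeta k)
  packet : ∀ k, PacketMeta k → CacheMeta k × CacheContent k → Packet k

attribute [instance] Scheme.fintypeCacheMeta Scheme.fintypeCacheContent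
  Scheme.fintypePacketMeta Scheme.fintypePacket

namespace Scheme

variable {K N B : ℕ}

/-- An outcome of the system: the demands, the library, the cache metadata and the queries. -/
structure Outcome (s : Scheme K N B) : Type where
  demand : Demands K N
  files : Library N B
  cacheMeta : ∀ k, s.CacheMeta k
  packetMeta : ∀ k, s.PacketMeta k

/-- The joint law when the demand vector has law `PD`: demands, files (i.i.d. uniform bits) and
cache metadata are independent, and the queries are drawn by the server given the demands and the
cache metadata. -/
def law (s : Scheme K N B) (PD : PMF (Demands K N)) : PMF s.Outcome :=
  PD.bind fun d =>
    (PMF.uniformOfFintype (Library N B)).bind fun F =>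
      s.placement.bind fun mc =>
        (s.query d mc).map fun mp => ⟨d, F, mc, mp⟩

/-- The cache `Z_k = (𝓜(C_k), C_k)` of user `k`. -/
def Z (s : Scheme K N B) (k : Fin K) (ω : s.Outcome) : s.CacheMeta k × s.CacheContent k :=
  (ω.cacheMeta k, s.cache k (ω.cacheMeta k) ω.files)

/-- The broadcast signal `X_k = (𝓜(P_k), P_k)` of user `k`. -/
def X (s : Scheme K N B) (k : Fin K) (ω : s.Outcome) : s.PacketMeta k × s.Packet k :=
  (ω.packetMeta k, s.packet k (ω.packetMeta k) (s.Z k ω))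

/-- All the broadcast signals `𝐗 = (X_1, …, X_K)`. -/
def allX (s : Scheme K N B) (ω : s.Outcome) : ∀ k, s.PacketMeta k × s.Packet k :=
  fun k => s.X k ω

/-- The cache size, decoding, privacy and load constraints for memory `M`, load `R` and slack `ε`,
when the demand vector has law `PD`. -/
structure Satisfies (s : Scheme K N B) (PD : PMF (Demands K N)) (M R ε : ℝ) : Prop where
  cacheSize : ∀ k, entropy (s.law PD) (s.Z k) ≤ B * (M + ε)
  decoding : ∀ k,
    condEntropy (s.law PD) (fun ω => ω.files (ω.demand k))
      (fun ω => (s.allX ω, s.Z k ω, ω.demand k)) ≤ B * ε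
  privacy : ∀ k,
    condMutualInfo (s.law PD) (fun ω => ω.demand) (fun ω => (s.allX ω, s.Z k ω))
      (fun ω => ω.demand k) = 0
  load : ∑ k, entropy (s.law PD) (s.X k) ≤ B * (R + ε)

end Scheme

/-- Load `R` is achievable with memory `M`: there are `ε_B ≥ 0` with `ε_B → 0` such that for all
large `B` some scheme meets all the constraints with slack `ε_B`. The scheme may not depend on the
law of the demand vector. -/
def Achievable (K N : ℕ) (M R : ℝ) : Prop :=
  ∃ ε : ℕ → ℝ, (∀ B, 0 ≤ ε B) ∧ Tendsto ε atTop (𝓝 0) ∧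
    ∀ᶠ B : ℕ in atTop, ∃ s : Scheme K N B,
      ∀ PD : PMF (Demands K N), s.Satisfies PD M R (ε B)

/-- The optimal load `R⋆` at memory `M`. -/
def optimalLoad (K N : ℕ) (M : ℝ) : ℝ := sInf {R : ℝ | Achievable K N M R}

/-- The number `U = (K - 1) N` of effective users. -/
def effectiveUsers (K N : ℕ) : ℕ := (K - 1) * N

/-- The memory-load pair with parameter `t` (for `K ≥ 2` one has `N ≤ U`). -/
def cornerPoint (K N t : ℕ) : ℝ × ℝ :=
  (((N : ℝ) + t - 1) / K,
    (((effectiveUsers K N).choose t : ℝ) - ((effectiveUsers K N - N).choose t : ℝ)) /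
      ((effectiveUsers K N).choose (t - 1) : ℝ))

/-- The memory-load pairs for `t = 1, …, U + 1`. -/
def cornerPoints (K N : ℕ) : Set (ℝ × ℝ) :=
  {p | ∃ t : ℕ, 1 ≤ t ∧ t ≤ effectiveUsers K N + 1 ∧ p = cornerPoint K N t}

/-- The lower convex envelope at abscissa `x` of a set of points of the plane: the lower boundary
of its convex hull. -/
def lowerConvexEnvelope (S : Set (ℝ × ℝ)) (x : ℝ) : ℝ :=
  sInf {y : ℝ | (x, y) ∈ convexHull ℝ S}

/-! ### The infimum defining the optimal load is over a set bounded below -/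

theorem entropy_nonneg {Ω α : Type} [Fintype α] (P : PMF Ω) (X : Ω → α) : 0 ≤ entropy P X := by
  refine Finset.sum_nonneg fun a _ => div_nonneg (Real.negMulLog_nonneg ENNReal.toReal_nonneg ?_)
    (Real.log_nonneg one_le_two)
  exact ENNReal.toReal_le_of_le_ofReal zero_le_one (by rw [ENNReal.ofReal_one]; exact PMF.coe_le_one _ a)

theorem Achievable.nonneg {K N : ℕ} (hN : 1 ≤ N) {M R : ℝ} (h : Achievable K N M R) : 0 ≤ R := by
  obtain ⟨ε, -, hlim, hev⟩ := h
  have hlim' : Tendsto (fun B => R + ε B) atTop (𝓝 (R + 0)) := hlim.const_add R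
  rw [add_zero] at hlim'
  refine ge_of_tendsto hlim' ?_
  filter_upwards [hev, eventually_gt_atTop 0] with B hB hB0
  obtain ⟨s, hs⟩ := hB
  have h1 := (hs (PMF.pure fun _ => ⟨0, hN⟩)).load
  have h2 : (0 : ℝ) ≤ B * (R + ε B) :=
    le_trans (Finset.sum_nonneg fun k _ => entropy_nonneg _ _) h1
  exact nonneg_of_mul_nonneg_right h2 (by exact_mod_cast hB0)

theorem bddBelow_achievable {K N : ℕ} (hN : 1 ≤ N) (M : ℝ) :
    BddBelow {R : ℝ | Achievable K N M R} :=
  ⟨0, fun _ h => h.nonneg hN⟩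

end D2DCaching

end

/-!
User `k` keeps a uniform secret `s k` with its cache, and the server announces `q = d - s`, which is
independent of the demands `d`. Every pair of a user `k ≠ j` and a possible secret `s` is an
effective user of the sender `j`, with demand `q k + s`; it is the real user `k` when `s = s k`.
Each sender serves its `U = (K - 1) N` effective users by the coded caching scheme of Maddah-Ali and
Avestimehr in the version of Yu, Maddah-Ali and Avestimehr. Whatever `q` is, the `N` effective users
of a fixed user `k` demand each file exactly once, so they can be taken as leaders: in
characteristic two the multicasts for the `(U choose t) - (U - N choose t)` sets of `t` effective
users that contain a leader determine all the others. Splitting the files between the schemes with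
different `t` gives the convex combinations of the corner points.
-/

noncomputable section

namespace D2DCaching

/-! ### Entropy -/

section Entropy

theorem sum_toReal_apply {α : Type*} [Fintype α] (p : PMF α) : ∑ a, (p a).toReal = 1 := by
  rw [← ENNReal.toReal_sum fun a _ => p.apply_ne_top a, ← tsum_fintype (L := .unconditional _),
    p.tsum_coe, ENNReal.toReal_one]

theorem sum_map_toReal_mul {α β : Type*} [Fintype α] [Fintype β] (p : PMF α) (g : α → β)
    (φ : β → ℝ) : ∑ b, (p.map g b).toReal * φ b = ∑ a, (p a).toReal * φ (g a) := by
  let _ : MeasurableSpace α := ⊤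
  let _ : MeasurableSpace β := ⊤
  have hmap := PMF.toMeasure_map p (f := g) measurable_from_top
  simpa only [← hmap, MeasureTheory.integral_map_of_stronglyMeasurable measurable_from_top
    (MeasureTheory.StronglyMeasurable.of_discrete (f := φ)), PMF.integral_eq_sum, smul_eq_mul]
    using (PMF.integral_eq_sum (p.map g) φ).symm

theorem map_apply_of_injective {α β : Type*} (p : PMF α) {f : α → β} (hf : Function.Injective f)
    (a : α) : p.map f (f a) = p a := by
  classical
  rw [PMF.map_apply, tsum_eq_single a fun b hb => if_neg fun h => hb (hf h).symm, if_pos rfl]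

theorem map_apply_eq_zero_of_notMem_range {α β : Type*} (p : PMF α) {f : α → β} {b : β}
    (hb : b ∉ Set.range f) : p.map f b = 0 := by
  rw [PMF.apply_eq_zero_iff, PMF.support_map]
  exact fun h => hb (Set.image_subset_range f _ h)

theorem map_equiv_uniformOfFintype {α β : Type*} [Fintype α] [Nonempty α] [Fintype β] [Nonempty β]
    (e : α ≃ β) : (PMF.uniformOfFintype α).map e = PMF.uniformOfFintype β := by
  ext b
  obtain ⟨a, rfl⟩ := e.surjective b
  rw [map_apply_of_injective _ e.injective, PMF.uniformOfFintype_apply,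
    PMF.uniformOfFintype_apply, Fintype.card_congr e]

/-- The joint law of `(A, B)` when `A` has law `p` and, given `A = a`, `B` has law `κ a`. -/
def jointLaw {α β : Type*} (p : PMF α) (κ : α → PMF β) : PMF (α × β) :=
  p.bind fun a => (κ a).map (Prod.mk a)

theorem jointLaw_apply {α β : Type*} (p : PMF α) (κ : α → PMF β) (a : α) (b : β) :
    jointLaw p κ (a, b) = p a * κ a b := by
  rw [jointLaw, PMF.bind_apply, tsum_eq_single a,
    map_apply_of_injective _ (Prod.mk_right_injective a)]
  intro a' ha'
  rw [map_apply_eq_zero_of_notMem_range, mul_zero]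
  rintro ⟨b', hb'⟩
  exact ha' (Prod.ext_iff.1 hb').1

theorem map_fst_jointLaw {α β : Type*} (p : PMF α) (κ : α → PMF β) :
    (jointLaw p κ).map Prod.fst = p := by
  rw [jointLaw, PMF.map_bind]
  simp only [PMF.map_comp]
  exact (congrArg p.bind (funext fun a => PMF.map_const (κ a) a)).trans p.bind_pure

theorem map_jointLaw_left {α β γ : Type*} (p : PMF α) (g : α → γ) (κ : γ → PMF β) :
    (jointLaw p fun a => κ (g a)).map (Prod.map g id) = jointLaw (p.map g) κ := by
  simp only [jointLaw, PMF.map_bind, PMF.bind_map, PMF.map_comp]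
  rfl

theorem map_jointLaw_right {α β γ : Type*} (p : PMF α) (κ : α → PMF β) (f : α → β → γ) :
    (jointLaw p κ).map (fun x => (x.1, f x.1 x.2)) = jointLaw p fun a => (κ a).map (f a) := by
  simp only [jointLaw, PMF.map_bind, PMF.map_comp]
  rfl

variable {Ω α β γ : Type} [Fintype α] [Fintype β] [Fintype γ]

theorem entropy_map {Ω' : Type} (P : PMF Ω) (f : Ω → Ω') (X : Ω' → α) :
    entropy (P.map f) X = entropy P (X ∘ f) := by
  rw [entropy, entropy, PMF.map_comp]

theorem entropy_map_id (P : PMF Ω) (X : Ω → α) : entropy (P.map X) id = entropy P X :=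
  entropy_map P X id

theorem entropy_comp_of_injective (P : PMF Ω) (X : Ω → α) {f : α → β}
    (hf : Function.Injective f) : entropy P (f ∘ X) = entropy P X := by
  refine (Fintype.sum_of_injective f hf _ _ (fun b hb => ?_) fun a => ?_).symm
  · rw [← PMF.map_comp, map_apply_eq_zero_of_notMem_range _ hb, ENNReal.toReal_zero,
      Real.negMulLog_zero, zero_div]
  · rw [← PMF.map_comp, map_apply_of_injective _ hf]

-- Jensen's inequality for `-x log x` at the average `1 / |α|` of the probabilities.
theorem entropy_le_logb_card (P : PMF Ω) (X : Ω → α) :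
    entropy P X ≤ Real.logb 2 (Fintype.card α) := by
  have hα : 0 < (Fintype.card α : ℝ) := by
    have : Nonempty α := P.support_nonempty.to_type.map X
    exact_mod_cast Fintype.card_pos
  have hsum : ∑ _a : α, (Fintype.card α : ℝ)⁻¹ = 1 := by
    rw [Finset.sum_const, Finset.card_univ, nsmul_eq_mul, mul_inv_cancel₀ hα.ne']
  have jensen := Real.concaveOn_negMulLog.le_map_sum (t := Finset.univ)
    (w := fun _ : α => (Fintype.card α : ℝ)⁻¹) (p := fun a => (P.map X a).toReal)
    (fun _ _ => by positivity) hsum fun _ _ => ENNReal.toReal_nonneg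
  simp only [smul_eq_mul, ← Finset.mul_sum, sum_toReal_apply, mul_one] at jensen
  rw [Real.negMulLog, Real.log_inv, neg_mul_neg, mul_le_mul_iff_right₀ (by positivity)] at jensen
  rw [entropy, ← Finset.sum_div, Real.logb]
  exact div_le_div_of_nonneg_right jensen (Real.log_nonneg one_le_two)

theorem entropy_le_logb_card_of_factorsThrough (P : PMF Ω) {X : Ω → α} {Y : Ω → β}
    (h : X.FactorsThrough Y) : entropy P X ≤ Real.logb 2 (Fintype.card β) := by
  have : Nonempty Ω := P.support_nonempty.to_type
  have : Nonempty α := ‹Nonempty Ω›.map X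
  obtain ⟨f, hf⟩ := (Function.factorsThrough_iff X).1 h
  have : Fintype (Set.range f) := Fintype.ofFinite _
  let X' : Ω → Set.range f := Set.rangeFactorization f ∘ Y
  calc entropy P X
      = entropy P (Subtype.val ∘ X') := by rw [hf]; rfl
    _ = entropy P X' := entropy_comp_of_injective P X' Subtype.val_injective
    _ ≤ Real.logb 2 (Fintype.card (Set.range f)) := entropy_le_logb_card P X'
    _ ≤ Real.logb 2 (Fintype.card β) := by
        have : Nonempty (Set.range f) := ‹Nonempty Ω›.map X'
        refine Real.logb_le_logb_of_le one_lt_two (by exact_mod_cast Fintype.card_pos) ?_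
        exact_mod_cast Fintype.card_le_of_surjective _ Set.rangeFactorization_surjective

theorem condEntropy_eq_zero_of_factorsThrough (P : PMF Ω) {X : Ω → α} {Y : Ω → β}
    (h : X.FactorsThrough Y) : condEntropy P X Y = 0 := by
  have : Nonempty Ω := P.support_nonempty.to_type
  have : Nonempty α := ‹Nonempty Ω›.map X
  obtain ⟨f, hf⟩ := (Function.factorsThrough_iff X).1 h
  rw [condEntropy, hf, sub_eq_zero]
  exact entropy_comp_of_injective P Y (f := fun y => (f y, y))
    fun _ _ hy => (Prod.ext_iff.1 hy).2

theorem entropy_jointLaw (p : PMF α) (κ : α → PMF β) :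
    entropy (jointLaw p κ) id = entropy p id + ∑ a, (p a).toReal * entropy (κ a) id := by
  simp only [entropy, PMF.map_id, Fintype.sum_prod_type, ← Finset.sum_add_distrib]
  refine Finset.sum_congr rfl fun a _ => ?_
  simp only [jointLaw_apply, ENNReal.toReal_mul, Real.negMulLog_mul, ← Finset.sum_div,
    Finset.sum_add_distrib, ← Finset.sum_mul, ← Finset.mul_sum, sum_toReal_apply]
  ring

-- The chain rule gives `H(D, Y) - H(D) = H(g D, Y) - H(g D)`: both are the mean entropy of `κ`.
theorem condMutualInfo_eq_zero_of_map_eq_jointLaw (P : PMF Ω) {D : Ω → α} {Y : Ω → β} {g : α → γ}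
    {κ : γ → PMF β}
    (h : P.map (fun ω => (D ω, Y ω)) = jointLaw (P.map D) fun a => κ (g a)) :
    condMutualInfo P D Y (fun ω => g (D ω)) = 0 := by
  have hDY : entropy P (fun ω => (D ω, Y ω)) =
      entropy P D + ∑ a, (P.map D a).toReal * entropy (κ (g a)) id := by
    rw [← entropy_map_id, h, entropy_jointLaw, entropy_map_id]
  have hgDY : entropy P (fun ω => (g (D ω), Y ω)) =
      entropy P (g ∘ D) + ∑ a, (P.map D a).toReal * entropy (κ (g a)) id := by
    have hlaw : P.map (fun ω => (g (D ω), Y ω)) = jointLaw (P.map (g ∘ D)) κ := by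
      rw [← PMF.map_comp, ← map_jointLaw_left, ← h, PMF.map_comp]
      rfl
    rw [← entropy_map_id, hlaw, entropy_jointLaw, entropy_map_id, ← PMF.map_comp,
      sum_map_toReal_mul]
  have hD : entropy P (fun ω => (D ω, g (D ω))) = entropy P D :=
    entropy_comp_of_injective P D (f := fun a => (a, g a))
      fun _ _ ha => (Prod.ext_iff.1 ha).1
  have hD_Yg : entropy P (fun ω => (D ω, (Y ω, g (D ω)))) = entropy P (fun ω => (D ω, Y ω)) :=
    entropy_comp_of_injective P (fun ω => (D ω, Y ω)) (f := fun x => (x.1, (x.2, g x.1)))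
      fun _ _ hx => Prod.ext (Prod.ext_iff.1 hx).1 (Prod.ext_iff.1 (Prod.ext_iff.1 hx).2).1
  have hYg : entropy P (fun ω => (Y ω, g (D ω))) = entropy P (fun ω => (g (D ω), Y ω)) :=
    entropy_comp_of_injective P (fun ω => (g (D ω), Y ω)) (f := Prod.swap) Prod.swap_injective
  rw [condMutualInfo, condEntropy, condEntropy, hD, hD_Yg, hYg, hDY, hgDY, Function.comp_def]
  ring

end Entropy

/-! ### Multicast messages -/

section Multicast

variable {V α R : Type*} [DecidableEq V]

/-- The multicast message for the set `S` of users, when user `u` demands file `a u` and `G i T` is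
the subfile of file `i` held exactly by the users in `T`: user `u` lacks the subfile held by the
other members of `S`. -/
def multicast [AddCommMonoid R] (a : V → α) (G : α → Finset V → R) (S : Finset V) : R :=
  ∑ u ∈ S, G (a u) (S.erase u)

theorem eq_of_multicast_insert_eq [AddCancelCommMonoid R] {a : V → α} {G G' : α → Finset V → R}
    {u : V} {T : Finset V} (hu : u ∉ T)
    (hmulticast : multicast a G (insert u T) = multicast a G' (insert u T))
    (hmem : ∀ i S, u ∈ S → S.card = T.card → G i S = G' i S) : G (a u) T = G' (a u) T := by
  have hrest : ∑ v ∈ T, G (a v) ((insert u T).erase v) =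
      ∑ v ∈ T, G' (a v) ((insert u T).erase v) := by
    refine Finset.sum_congr rfl fun v hv => hmem _ _ ?_ ?_
    · exact Finset.mem_erase.2 ⟨fun h => hu (h ▸ hv), Finset.mem_insert_self u T⟩
    · rw [Finset.card_erase_of_mem (Finset.mem_insert_of_mem hv), Finset.card_insert_of_notMem hu,
        Nat.add_sub_cancel]
  rw [multicast, multicast, Finset.sum_insert hu, Finset.sum_insert hu, hrest,
    Finset.erase_insert hu] at hmulticast
  exact add_right_cancel hmulticast

theorem insert_image_update [Fintype α] [DecidableEq α] (φ : α → V) (i : α) (u : V) :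
    insert (φ i) (Finset.univ.image (Function.update φ i u)) =
      insert u (Finset.univ.image φ) := by
  have himage (ψ : α → V) :
      Finset.univ.image ψ = insert (ψ i) ((Finset.univ.erase i).image ψ) := by
    rw [← Finset.image_insert, Finset.insert_erase (Finset.mem_univ i)]
  have hrest : (Finset.univ.erase i).image (Function.update φ i u) =
      (Finset.univ.erase i).image φ :=
    Finset.image_congr fun j hj => Function.update_of_ne (Finset.ne_of_mem_erase hj) u φ
  rw [himage, himage φ, hrest, Function.update_self, Finset.insert_comm]

section Transversals

variable [Fintype V] [Fintype α] [DecidableEq α]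

/-- The transversals in `T` of the demand map `a`: the ways of choosing, for each file, a user in
`T` demanding this file. -/
def transversals (a : V → α) (T : Finset V) : Finset (α → V) :=
  Finset.univ.filter fun φ => ∀ i, φ i ∈ T ∧ a (φ i) = i

variable {a : V → α} {T : Finset V} {φ : α → V}

theorem mem_transversals : φ ∈ transversals a T ↔ ∀ i, φ i ∈ T ∧ a (φ i) = i := by
  simp only [transversals, Finset.mem_filter_univ]

theorem image_subset_of_mem_transversals (hφ : φ ∈ transversals a T) :
    Finset.univ.image φ ⊆ T :=
  Finset.image_subset_iff.2 fun i _ => (mem_transversals.1 hφ i).1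

theorem card_image_of_mem_transversals (hφ : φ ∈ transversals a T) :
    (Finset.univ.image φ).card = Fintype.card α :=
  Finset.card_image_of_injective _
    (Function.LeftInverse.injective fun i => (mem_transversals.1 hφ i).2)

theorem mem_image_iff_of_mem_transversals (hφ : φ ∈ transversals a T) {v : V} :
    v ∈ Finset.univ.image φ ↔ φ (a v) = v := by
  simp only [Finset.mem_image, Finset.mem_univ, true_and]
  refine ⟨?_, fun h => ⟨_, h⟩⟩
  rintro ⟨i, rfl⟩
  rw [(mem_transversals.1 hφ i).2]

theorem update_mem_transversals (hφ : φ ∈ transversals a T) {u : V} (hu : u ∈ T) :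
    Function.update φ (a u) u ∈ transversals a T := by
  rw [mem_transversals] at hφ ⊢
  intro i
  rcases eq_or_ne i (a u) with rfl | hi
  · rw [Function.update_self]
    exact ⟨hu, rfl⟩
  · rw [Function.update_of_ne hi]
    exact hφ i

-- Exchanging `u` with the user chosen for the file of `u` pairs off equal summands.
theorem sum_multicast_sdiff_transversals [AddCommGroup R] (hR : ∀ x : R, x + x = 0) (a : V → α)
    (G : α → Finset V → R) (T : Finset V) :
    ∑ φ ∈ transversals a T, multicast a G (T \ Finset.univ.image φ) = 0 := by
  simp only [multicast, Finset.sum_sigma']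
  have hdemand {φ : α → V} (hφ : φ ∈ transversals a T) (u : V) : a (φ (a u)) = a u :=
    (mem_transversals.1 hφ _).2
  refine Finset.sum_involution
    (fun x _ => ⟨Function.update x.1 (a x.2) x.2, x.1 (a x.2)⟩) ?_ ?_ ?_ ?_
  all_goals
    rintro ⟨φ, u⟩ hx
    obtain ⟨hφ, hu⟩ := Finset.mem_sigma.1 hx
    obtain ⟨huT, huφ⟩ := Finset.mem_sdiff.1 hu
    rw [mem_image_iff_of_mem_transversals hφ] at huφ
    dsimp only at *
  · rw [← Finset.sdiff_insert, ← Finset.sdiff_insert, insert_image_update, hdemand hφ]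
    exact hR _
  · rintro - heq
    exact huφ (congrArg Sigma.snd heq)
  · have hφ' := update_mem_transversals hφ huT
    refine Finset.mem_sigma.2 ⟨hφ', Finset.mem_sdiff.2 ⟨(mem_transversals.1 hφ _).1, ?_⟩⟩
    rw [mem_image_iff_of_mem_transversals hφ', hdemand hφ, Function.update_self]
    exact Ne.symm huφ
  · simp only [hdemand hφ, Function.update_idem, Function.update_eq_self, Function.update_self]

end Transversals

theorem multicast_eq_of_eq_on_leaders [Finite V] [Fintype α] [AddCommGroup R]
    (hR : ∀ x : R, x + x = 0) {a : V → α} {leader : α → V} (hleader : ∀ i, a (leader i) = i)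
    {G G' : α → Finset V → R} (S : Finset V)
    (h : ∀ S' : Finset V, S'.card = S.card → ¬ Disjoint S' (Finset.univ.image leader) →
      multicast a G S' = multicast a G' S') :
    multicast a G S = multicast a G' S := by
  classical
  have := Fintype.ofFinite V
  by_cases hS : Disjoint S (Finset.univ.image leader)
  swap
  · exact h S rfl hS
  let T := S ∪ Finset.univ.image leader
  have hleaderT (i : α) : leader i ∈ T :=
    Finset.mem_union_right _ (Finset.mem_image_of_mem _ (Finset.mem_univ i))
  have hmem : leader ∈ transversals a T := mem_transversals.2 fun i => ⟨hleaderT i, hleader i⟩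
  have hTS : T \ Finset.univ.image leader = S := by
    rw [Finset.union_sdiff_right, Finset.sdiff_eq_self_of_disjoint hS]
  have hrest : ∀ φ ∈ (transversals a T).erase leader,
      multicast a G (T \ Finset.univ.image φ) = multicast a G' (T \ Finset.univ.image φ) := by
    intro φ hφ
    obtain ⟨hne, hφ⟩ := Finset.mem_erase.1 hφ
    refine h _ ?_ ?_
    · rw [Finset.card_sdiff_of_subset (image_subset_of_mem_transversals hφ),
        card_image_of_mem_transversals hφ, ← card_image_of_mem_transversals hmem,
        ← Finset.card_sdiff_of_subset (image_subset_of_mem_transversals hmem), hTS]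
    · obtain ⟨i, hi⟩ := Function.ne_iff.1 hne
      refine Finset.not_disjoint_iff.2 ⟨leader i, Finset.mem_sdiff.2 ⟨hleaderT i, ?_⟩,
        Finset.mem_image_of_mem _ (Finset.mem_univ i)⟩
      rwa [mem_image_iff_of_mem_transversals hφ, hleader]
  have hG := sum_multicast_sdiff_transversals hR a G T
  have hG' := sum_multicast_sdiff_transversals hR a G' T
  rw [← Finset.add_sum_erase _ _ hmem, hTS] at hG hG'
  rw [Finset.sum_congr rfl hrest] at hG
  exact add_right_cancel (hG.trans hG'.symm)

end Multicast

/-! ### Counting sets of users -/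

section Counting

theorem card_sigma_subtype_fin {ι : Type*} [Fintype ι] (p : ι → Prop) [DecidablePred p]
    (f : ι → ℕ) : Fintype.card (Σ i : {i // p i}, Fin (f i)) = ∑ i with p i, f i := by
  simp only [Fintype.card_sigma, Fintype.card_fin]
  exact (Finset.sum_subtype _ (fun _ => Finset.mem_filter_univ _) f).symm

theorem sum_apply_card {V R : Type*} [Fintype V] [AddCommMonoid R] (f : ℕ → R) :
    ∑ S : Finset V, f S.card =
      ∑ m ∈ Finset.range (Fintype.card V + 1), (Fintype.card V).choose m • f m := by
  rw [← Finset.powerset_univ, Finset.sum_powerset_apply_card, Finset.card_univ]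

variable {V : Type*} [Fintype V] [DecidableEq V]

theorem sum_disjoint_apply_card {R : Type*} [AddCommMonoid R] (L : Finset V) (f : ℕ → R) :
    ∑ S with Disjoint S L, f S.card =
      ∑ m ∈ Finset.range (Fintype.card V + 1), (Fintype.card V - L.card).choose m • f m := by
  have hfilter : Finset.univ.filter (fun S => Disjoint S L) = Lᶜ.powerset := by
    ext S
    simp only [Finset.mem_filter_univ, Finset.mem_powerset, Finset.subset_compl_iff_disjoint_right]
  rw [hfilter, Finset.sum_powerset_apply_card, Finset.card_compl]
  refine Finset.sum_subset (Finset.range_mono (by lia)) fun m _ hm => ?_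
  rw [Finset.mem_range, not_lt] at hm
  rw [Nat.choose_eq_zero_of_lt hm, zero_nsmul]

theorem sum_notMem_apply_card {R : Type*} [AddCommMonoid R] (u : V) (f : ℕ → R) :
    ∑ S : Finset V with u ∉ S, f S.card =
      ∑ m ∈ Finset.range (Fintype.card V + 1), (Fintype.card V - 1).choose m • f m := by
  simpa only [Finset.disjoint_singleton_right, Finset.card_singleton]
    using sum_disjoint_apply_card {u} f

theorem sum_not_disjoint_apply_card_sub_one (L : Finset V) (f : ℕ → ℝ) :
    ∑ S with ¬ Disjoint S L, f (S.card - 1) =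
      ∑ t ∈ Finset.range (Fintype.card V + 1), (((Fintype.card V).choose (t + 1) : ℝ) -
        ((Fintype.card V - L.card).choose (t + 1) : ℝ)) * f t := by
  have hsplit := Finset.sum_filter_add_sum_filter_not Finset.univ (fun S => Disjoint S L)
    fun S => f (S.card - 1)
  rw [sum_disjoint_apply_card L fun m => f (m - 1), sum_apply_card fun m => f (m - 1)] at hsplit
  have hchoose : (Fintype.card V - L.card).choose (Fintype.card V + 1) = 0 :=
    Nat.choose_eq_zero_of_lt (Nat.lt_succ_of_le (Nat.sub_le _ _))
  rw [← eq_sub_iff_add_eq', ← Finset.sum_sub_distrib, Finset.sum_range_succ'] at hsplit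
  rw [hsplit, Finset.sum_range_succ, Nat.choose_succ_self, hchoose]
  simp only [nsmul_eq_mul, Nat.add_sub_cancel, Nat.choose_zero_right, sub_self, sub_mul,
    zero_mul]

end Counting

/-! ### The virtual-user scheme -/

/-- The effective users served by the sender `j`: one for each user `k ≠ j` and each value of the
secret of `k`. -/
abbrev EffectiveUser {K : ℕ} (N : ℕ) (j : Fin K) : Type := {k : Fin K // k ≠ j} × Fin N

theorem card_effectiveUser {K N : ℕ} (j : Fin K) :
    Fintype.card (EffectiveUser N j) = effectiveUsers K N := by
  rw [Fintype.card_prod, Fintype.card_subtype_compl, Fintype.card_subtype_eq, Fintype.card_fin,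
    Fintype.card_fin, effectiveUsers]

/-- A partition of the bits of a file: for each sender `j` and each set `T` of effective users of
`j`, a block of `ℓ #T` bits, which `j` and the effective users in `T` store. The position
`pos j T m` of the `m`-th bit of the block is only meaningful for `m < ℓ #T`. -/
structure Subpacketization (K N B : ℕ) (ℓ : ℕ → ℕ) where
  pos : ∀ j : Fin K, Finset (EffectiveUser N j) → ℕ → Fin B
  pos_injective : Function.Injective
    fun x : Σ j, Σ T : Finset (EffectiveUser N j), Fin (ℓ T.card) => pos x.1 x.2.1 x.2.2

namespace Subpacketization

variable {K N B : ℕ} {ℓ : ℕ → ℕ}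

theorem nonempty (hB : 0 < B)
    (h : K * ∑ t ∈ Finset.range (effectiveUsers K N + 1),
      (effectiveUsers K N).choose t * ℓ t ≤ B) : Nonempty (Subpacketization K N B ℓ) := by
  have hcard : Fintype.card (Σ j : Fin K, Σ T : Finset (EffectiveUser N j), Fin (ℓ T.card)) ≤
      Fintype.card (Fin B) := by
    refine le_trans (le_of_eq ?_) (h.trans (Fintype.card_fin B).ge)
    simp only [Fintype.card_sigma, Fintype.card_fin, sum_apply_card ℓ, card_effectiveUser,
      smul_eq_mul, Finset.sum_const, Finset.card_univ]
  obtain ⟨e⟩ := Function.Embedding.nonempty_of_card_le hcard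
  refine ⟨⟨fun j T m => if hm : m < ℓ T.card then e ⟨j, T, m, hm⟩ else ⟨0, hB⟩, ?_⟩⟩
  simpa only [Fin.is_lt, dite_true] using e.injective

variable (σ : Subpacketization K N B ℓ)

open Classical in
/-- The positions of the bits of each file that user `k` stores when its secret is `s`: all but
those in blocks of other senders whose storing set misses the effective user `(k, s)`. -/
def storedBits (k : Fin K) (s : Fin N) : Finset (Fin B) :=
  Finset.univ.filter fun b => ∀ (j : Fin K) (T : Finset (EffectiveUser N j)) (m : ℕ),
    m < ℓ T.card → σ.pos j T m = b → ∀ hkj : k ≠ j, (⟨k, hkj⟩, s) ∈ T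

theorem pos_mem_storedBits {k j : Fin K} {s : Fin N} {T : Finset (EffectiveUser N j)} {m : ℕ}
    (hm : m < ℓ T.card) :
    σ.pos j T m ∈ σ.storedBits k s ↔ ∀ hkj : k ≠ j, (⟨k, hkj⟩, s) ∈ T := by
  rw [storedBits, Finset.mem_filter_univ]
  refine ⟨fun h => h j T m hm rfl, fun h j' T' m' hm' hpos => ?_⟩
  have := @σ.pos_injective ⟨j', T', m', hm'⟩ ⟨j, T, m, hm⟩ hpos
  cases this
  exact h

/-- The library with the bits that user `k` with secret `s` does not store set to `false`. -/
def cachedPart (k : Fin K) (s : Fin N) (F : Library N B) : Library N B :=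
  fun i b => if b ∈ σ.storedBits k s then F i b else false

theorem eq_of_cachedPart_eq {k : Fin K} {s : Fin N} {F F' : Library N B}
    (h : σ.cachedPart k s F = σ.cachedPart k s F') (i : Fin N) {b : Fin B}
    (hb : b ∈ σ.storedBits k s) : F i b = F' i b := by
  simpa only [cachedPart, if_pos hb] using congrFun (congrFun h i) b

theorem cachedPart_eq_of_eq {k : Fin K} {s : Fin N} {F F' : Library N B}
    (h : ∀ i, ∀ b ∈ σ.storedBits k s, F i b = F' i b) :
    σ.cachedPart k s F = σ.cachedPart k s F' := by
  funext i b
  exact ite_congr rfl (h i b) fun _ => rfl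

/-- The demand of an effective user for the query `q`: the effective user `(k, s)` acts as if `s`
were the secret by which user `k` shifted its demand. -/
def effectiveDemand (q : Demands K N) (j : Fin K) (u : EffectiveUser N j) : Fin N :=
  q u.1 + u.2

/-- The messages of sender `j` for the query `q`, with `Bool` as the field of two elements: a
multicast for each set `S` of effective users and each index in the blocks of `j` for sets of
`#S - 1` effective users. -/
def messages (j : Fin K) (q : Demands K N) (F : Library N B) :
    (Σ S : Finset (EffectiveUser N j), Fin (ℓ (S.card - 1))) → Bool :=
  fun x => multicast (effectiveDemand q j) (fun i T => F i (σ.pos j T x.2)) x.1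

theorem messages_cachedPart (j : Fin K) (s : Fin N) (q : Demands K N) (F : Library N B) :
    σ.messages j q (σ.cachedPart j s F) = σ.messages j q F := by
  funext x
  refine Finset.sum_congr rfl fun u hu => if_pos ?_
  have hm : x.2 < ℓ (x.1.erase u).card := by
    rw [Finset.card_erase_of_mem hu]
    exact x.2.2
  exact (σ.pos_mem_storedBits hm).2 fun hjj => absurd rfl hjj

-- A bit missing from the cache is in a block of a sender `j` for a set `T` without the effective
-- user `(k, s)` of `j`; the multicast for `insert (k, s) T` delivers it.
theorem file_eq_of_messages_eq {k : Fin K} {s : Fin N} {q : Demands K N} {F F' : Library N B}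
    (hcache : σ.cachedPart k s F = σ.cachedPart k s F')
    (hmessages : ∀ j, σ.messages j q F = σ.messages j q F') : F (q k + s) = F' (q k + s) := by
  funext b
  by_cases hb : b ∈ σ.storedBits k s
  · exact σ.eq_of_cachedPart_eq hcache _ hb
  simp only [storedBits, Finset.mem_filter_univ, not_forall] at hb
  obtain ⟨j, T, m, hm, rfl, hkj, hT⟩ := hb
  have hm' : m < ℓ ((insert (⟨k, hkj⟩, s) T).card - 1) := by
    rwa [Finset.card_insert_of_notMem hT, Nat.add_sub_cancel]
  have hmulticast := congrFun (hmessages j) ⟨insert (⟨k, hkj⟩, s) T, m, hm'⟩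
  refine eq_of_multicast_insert_eq hT hmulticast fun i S huS hS => ?_
  exact σ.eq_of_cachedPart_eq hcache i
    ((σ.pos_mem_storedBits (hm.trans_eq (congrArg ℓ hS.symm))).2 fun _ => huS)

theorem card_storedBits_add_le (k : Fin K) (s : Fin N) :
    (σ.storedBits k s).card + (K - 1) * ∑ t ∈ Finset.range (effectiveUsers K N + 1),
      (effectiveUsers K N - 1).choose t * ℓ t ≤ B := by
  classical
  let f : (Σ j : {j : Fin K // j ≠ k},
      Σ T : {T : Finset (EffectiveUser N j.1) // (⟨k, j.2.symm⟩, s) ∉ T}, Fin (ℓ T.1.card)) →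
      Fin B := fun x => σ.pos x.1 x.2.1 x.2.2
  have hf : Function.Injective f := by
    rintro ⟨j, T, m⟩ ⟨j', T', m'⟩ hpos
    have hblock := @σ.pos_injective ⟨j, T, m⟩ ⟨j', T', m'⟩ hpos
    obtain ⟨hj, hTm⟩ := Sigma.mk.inj hblock
    obtain rfl : j = j' := Subtype.ext hj
    obtain ⟨hT, hm⟩ := Sigma.mk.inj (eq_of_heq hTm)
    obtain rfl : T = T' := Subtype.ext hT
    rw [eq_of_heq hm]
  have hcard : (Finset.univ.image f).card = (K - 1) *
      ∑ t ∈ Finset.range (effectiveUsers K N + 1), (effectiveUsers K N - 1).choose t * ℓ t := by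
    rw [Finset.card_image_of_injective _ hf, Finset.card_univ, Fintype.card_sigma]
    simp only [card_sigma_subtype_fin _ fun T : Finset (EffectiveUser N _) => ℓ T.card,
      sum_notMem_apply_card _ ℓ, card_effectiveUser, Finset.sum_const, Finset.card_univ,
      Fintype.card_subtype_compl, Fintype.card_subtype_eq, Fintype.card_fin, smul_eq_mul]
  have hdisj : Disjoint (σ.storedBits k s) (Finset.univ.image f) := by
    refine Finset.disjoint_right.2 fun b hb hmem => ?_
    obtain ⟨⟨j, T, m⟩, -, rfl⟩ := Finset.mem_image.1 hb
    exact T.2 ((σ.pos_mem_storedBits m.2).1 hmem j.2.symm)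
  rw [← hcard, ← Finset.card_union_of_disjoint hdisj]
  exact (Finset.card_le_univ _).trans_eq (Fintype.card_fin B)

variable [NeZero N]

theorem messages_eq_of_eq_on_row {j : Fin K} (r : {k : Fin K // k ≠ j}) {q : Demands K N}
    {F F' : Library N B}
    (h : ∀ x : Σ S : Finset (EffectiveUser N j), Fin (ℓ (S.card - 1)),
      ¬ Disjoint x.1 ({r} ×ˢ Finset.univ) → σ.messages j q F x = σ.messages j q F' x) :
    σ.messages j q F = σ.messages j q F' := by
  let leader : Fin N → EffectiveUser N j := fun i => (r, i - q r)
  have hleader (i : Fin N) : effectiveDemand q j (leader i) = i := add_sub_cancel _ _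
  have himage : Finset.univ.image leader = {r} ×ˢ Finset.univ := by
    ext ⟨r', i⟩
    rw [Finset.mem_image, Finset.mem_product, Finset.mem_singleton]
    refine ⟨?_, fun h => ⟨i + q r, Finset.mem_univ _, Prod.ext h.1.symm (add_sub_cancel_right _ _)⟩⟩
    rintro ⟨i', -, h⟩
    exact ⟨(congrArg Prod.fst h).symm, Finset.mem_univ _⟩
  funext ⟨S, m⟩
  refine multicast_eq_of_eq_on_leaders BooleanRing.add_self hleader S fun S' hS' hdisj => ?_
  rw [himage] at hdisj
  exact h ⟨S', m, by rw [hS']; exact m.2⟩ hdisj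

/-- The virtual-user scheme. The metadata of the cache of user `k` is a uniform secret `s k`, its
content is the library with all other bits set to `false`, and the server tells every user the
shifted demand vector `d - s`. -/
def scheme : Scheme K N B where
  CacheMeta _ := Fin N
  CacheContent _ := Library N B
  PacketMeta _ := Demands K N
  Packet j := (Σ S : Finset (EffectiveUser N j), Fin (ℓ (S.card - 1))) → Bool
  placement := PMF.uniformOfFintype (Fin K → Fin N)
  cache := σ.cachedPart
  query d s := PMF.pure fun _ => d - s
  packet j q z := σ.messages j q z.2

/-- The outcome of the virtual-user scheme for the demands `d`, the library `x.1` and the query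
`x.2`. The query replaces the secrets as the source of randomness, as it is independent of the
demands. -/
def outcome (d : Demands K N) (x : Library N B × Demands K N) : σ.scheme.Outcome :=
  ⟨d, x.1, d - x.2, fun _ => x.2⟩

/-- The joint law of the library and the query in the virtual-user scheme. -/
def libraryQueryLaw (K N B : ℕ) [NeZero N] : PMF (Library N B × Demands K N) :=
  jointLaw (PMF.uniformOfFintype (Library N B)) fun _ => PMF.uniformOfFintype (Demands K N)

theorem law_scheme (PD : PMF (Demands K N)) :
    σ.scheme.law PD =
      (jointLaw PD fun _ => libraryQueryLaw K N B).map fun x => σ.outcome x.1 x.2 := by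
  have hquery (d : Demands K N) (F : Library N B) :
      ((PMF.uniformOfFintype (Fin K → Fin N)).bind fun s =>
        (σ.scheme.query d s).map fun q => (⟨d, F, s, q⟩ : σ.scheme.Outcome)) =
      (PMF.uniformOfFintype (Demands K N)).map fun q => σ.outcome d (F, q) := by
    conv_rhs => rw [← map_equiv_uniformOfFintype (Equiv.subLeft d), PMF.map_comp]
    refine congrArg (PMF.uniformOfFintype _).bind (funext fun s => ?_)
    simp only [scheme, PMF.pure_map, Function.comp_apply, outcome, Equiv.subLeft_apply,
      sub_sub_cancel]
  simp only [jointLaw, libraryQueryLaw, PMF.map_bind, PMF.map_comp]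
  exact congrArg PD.bind (funext fun d => congrArg _ (funext (hquery d)))

theorem X_outcome (j : Fin K) (d : Demands K N) (x : Library N B × Demands K N) :
    σ.scheme.X j (σ.outcome d x) = (x.2, σ.messages j x.2 x.1) :=
  congrArg (Prod.mk x.2) (σ.messages_cachedPart j _ _ _)

theorem allX_outcome (d : Demands K N) (x : Library N B × Demands K N) :
    σ.scheme.allX (σ.outcome d x) = fun j => (x.2, σ.messages j x.2 x.1) :=
  funext fun j => σ.X_outcome j d x

theorem Z_outcome (k : Fin K) (d : Demands K N) (x : Library N B × Demands K N) :
    σ.scheme.Z k (σ.outcome d x) = (d k - x.2 k, σ.cachedPart k (d k - x.2 k) x.1) :=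
  rfl

theorem condEntropy_scheme (PD : PMF (Demands K N)) (k : Fin K) :
    condEntropy (σ.scheme.law PD) (fun ω => ω.files (ω.demand k))
      (fun ω => (σ.scheme.allX ω, σ.scheme.Z k ω, ω.demand k)) = 0 := by
  rw [law_scheme, condEntropy, entropy_map, entropy_map]
  refine condEntropy_eq_zero_of_factorsThrough _ ?_
  rintro ⟨d, F, q⟩ ⟨d', F', q'⟩ hview
  have hX := congrArg Prod.fst hview
  have hcache := congrArg (fun v => v.2.1.2) hview
  have hd : d k = d' k := congrArg (fun v => v.2.2) hview
  simp only [allX_outcome] at hX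
  simp only [Z_outcome] at hcache
  obtain rfl : q = q' := congrArg Prod.fst (congrFun hX k)
  rw [← hd] at hcache
  have hfile := σ.file_eq_of_messages_eq hcache fun j => congrArg Prod.snd (congrFun hX j)
  rw [add_sub_cancel] at hfile
  exact hfile.trans (congrArg F' hd)

theorem condMutualInfo_scheme (PD : PMF (Demands K N)) (k : Fin K) :
    condMutualInfo (σ.scheme.law PD) (fun ω => ω.demand)
      (fun ω => (σ.scheme.allX ω, σ.scheme.Z k ω)) (fun ω => ω.demand k) = 0 := by
  let view (ω : σ.scheme.Outcome) := (σ.scheme.allX ω, σ.scheme.Z k ω)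
  have hview (d : Demands K N) (x : Library N B × Demands K N) :
      view (σ.outcome d x) = view (σ.outcome (fun _ => d k) x) := by
    simp only [view, allX_outcome, Z_outcome]
  have hdemand : (σ.scheme.law PD).map Scheme.Outcome.demand = PD := by
    rw [law_scheme, PMF.map_comp]
    exact map_fst_jointLaw _ _
  refine condMutualInfo_eq_zero_of_map_eq_jointLaw (D := Scheme.Outcome.demand) (Y := view)
    (g := fun d => d k)
    (κ := fun c => (libraryQueryLaw K N B).map fun x => view (σ.outcome (fun _ => c) x)) _ ?_
  rw [hdemand, law_scheme, PMF.map_comp,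
    ← map_jointLaw_right PD _ fun d x => view (σ.outcome (fun _ => d k) x)]
  exact congrArg (PMF.map · _) (funext fun x => congrArg (Prod.mk x.1) (hview x.1 x.2))

theorem logb_card_storedContent_le (k : Fin K) :
    Real.logb 2 (Fintype.card (Σ s : Fin N, Fin N × σ.storedBits k s → Bool)) ≤
      Real.logb 2 N + N * (B - ((K - 1) * ∑ t ∈ Finset.range (effectiveUsers K N + 1),
        (effectiveUsers K N - 1).choose t * ℓ t : ℕ)) := by
  set c := (K - 1) * ∑ t ∈ Finset.range (effectiveUsers K N + 1),
    (effectiveUsers K N - 1).choose t * ℓ t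
  have hcB : c ≤ B := (Nat.le_add_left _ _).trans (σ.card_storedBits_add_le k 0)
  have hN : (N : ℝ) ≠ 0 := NeZero.ne _
  have hcard : Fintype.card (Σ s : Fin N, Fin N × σ.storedBits k s → Bool) ≤
      N * 2 ^ (N * (B - c)) := by
    rw [Fintype.card_sigma]
    refine (Finset.sum_le_card_nsmul _ _ (2 ^ (N * (B - c))) fun s _ => ?_).trans_eq
      (by rw [Finset.card_univ, Fintype.card_fin, smul_eq_mul])
    rw [Fintype.card_fun, Fintype.card_prod, Fintype.card_bool, Fintype.card_fin,
      Fintype.card_coe]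
    exact Nat.pow_le_pow_right two_pos
      (Nat.mul_le_mul_left N (Nat.le_sub_of_add_le (σ.card_storedBits_add_le k s)))
  have hcard_pos : 0 < Fintype.card (Σ s : Fin N, Fin N × σ.storedBits k s → Bool) :=
    Fintype.card_pos_iff.2 ⟨⟨0, fun _ => false⟩⟩
  calc Real.logb 2 (Fintype.card (Σ s : Fin N, Fin N × σ.storedBits k s → Bool))
      ≤ Real.logb 2 (N * 2 ^ (N * (B - c)) : ℕ) :=
        Real.logb_le_logb_of_le one_lt_two (by exact_mod_cast hcard_pos) (by exact_mod_cast hcard)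
    _ = Real.logb 2 N + N * (B - c) := by
        push_cast
        rw [Real.logb_mul hN (by positivity), Real.logb_pow, Real.logb_self_eq_one one_lt_two,
          mul_one, Nat.cast_mul, Nat.cast_sub hcB]

theorem entropy_Z_le (PD : PMF (Demands K N)) (k : Fin K) :
    entropy (σ.scheme.law PD) (σ.scheme.Z k) ≤ Real.logb 2 N +
      N * (B - ((K - 1) * ∑ t ∈ Finset.range (effectiveUsers K N + 1),
        (effectiveUsers K N - 1).choose t * ℓ t : ℕ)) := by
  have hfactors : (σ.scheme.Z k ∘ fun x => σ.outcome x.1 x.2).FactorsThrough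
      fun x : Demands K N × Library N B × Demands K N =>
        (⟨x.1 k - x.2.2 k, fun y => x.2.1 y.1 y.2⟩ :
          Σ s : Fin N, Fin N × σ.storedBits k s → Bool) := by
    rintro ⟨d, F, q⟩ ⟨d', F', q'⟩ hstored
    obtain ⟨hs, hF⟩ := Sigma.mk.inj hstored
    simp only [Function.comp_apply, Z_outcome] at hs hF ⊢
    rw [← hs] at hF ⊢
    exact congrArg (Prod.mk _)
      (σ.cachedPart_eq_of_eq fun i b hb => congrFun (eq_of_heq hF) (i, ⟨b, hb⟩))
  rw [law_scheme, entropy_map]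
  exact (entropy_le_logb_card_of_factorsThrough _ hfactors).trans
    (σ.logb_card_storedContent_le k)

theorem entropy_X_le (hK : 2 ≤ K) (PD : PMF (Demands K N)) (j : Fin K) :
    entropy (σ.scheme.law PD) (σ.scheme.X j) ≤ K * Real.logb 2 N +
      ∑ t ∈ Finset.range (effectiveUsers K N + 1), (((effectiveUsers K N).choose (t + 1) : ℝ) -
        ((effectiveUsers K N - N).choose (t + 1) : ℝ)) * ℓ t := by
  have : Nontrivial (Fin K) := Fin.nontrivial_iff_two_le.2 hK
  obtain ⟨r, hr⟩ := exists_ne j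
  let row : Finset (EffectiveUser N j) := {⟨r, hr⟩} ×ˢ Finset.univ
  have hrow : row.card = N := by
    rw [Finset.card_product, Finset.card_singleton, one_mul, Finset.card_univ, Fintype.card_fin]
  have hfactors : (σ.scheme.X j ∘ fun x => σ.outcome x.1 x.2).FactorsThrough
      fun x : Demands K N × Library N B × Demands K N =>
        ((x.2.2, fun y => σ.messages j x.2.2 x.2.1 ⟨y.1, y.2⟩) : Demands K N ×
          ((Σ S : {S : Finset (EffectiveUser N j) // ¬ Disjoint S row},
            Fin (ℓ (S.1.card - 1))) → Bool)) := by
    rintro ⟨d, F, q⟩ ⟨d', F', q'⟩ hmessages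
    obtain ⟨rfl, hF⟩ := Prod.mk.inj hmessages
    simp only [Function.comp_apply, X_outcome]
    exact congrArg (Prod.mk _)
      (σ.messages_eq_of_eq_on_row ⟨r, hr⟩ fun x hx => congrFun hF ⟨⟨x.1, hx⟩, x.2⟩)
  have hcard : (Fintype.card (Σ S : {S : Finset (EffectiveUser N j) // ¬ Disjoint S row},
      Fin (ℓ (S.1.card - 1))) : ℝ) = ∑ t ∈ Finset.range (effectiveUsers K N + 1),
        (((effectiveUsers K N).choose (t + 1) : ℝ) -
          ((effectiveUsers K N - N).choose (t + 1) : ℝ)) * ℓ t := by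
    have hsum := sum_not_disjoint_apply_card_sub_one row fun m => (ℓ m : ℝ)
    rw [card_effectiveUser, hrow] at hsum
    rw [card_sigma_subtype_fin _ fun S : Finset (EffectiveUser N j) => ℓ (S.card - 1),
      Nat.cast_sum, hsum]
  rw [law_scheme, entropy_map]
  refine (entropy_le_logb_card_of_factorsThrough _ hfactors).trans_eq ?_
  have hN : (N : ℝ) ≠ 0 := NeZero.ne _
  rw [← hcard, Fintype.card_prod, Fintype.card_fun, Fintype.card_fun, Fintype.card_fin,
    Fintype.card_fin, Fintype.card_bool]
  push_cast
  rw [Real.logb_mul (by positivity) (by positivity), Real.logb_pow, Real.logb_pow,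
    Real.logb_self_eq_one one_lt_two, mul_one]

end Subpacketization

/-! ### Memory sharing -/

section MemorySharing

theorem mul_sum_choose_pred_mul (U : ℕ) (f : ℕ → ℝ) :
    (U : ℝ) * ∑ t ∈ Finset.range (U + 1), ((U - 1).choose t : ℝ) * f t =
      ∑ t ∈ Finset.range (U + 1), ((U : ℝ) - t) * (U.choose t * f t) := by
  rw [Finset.mul_sum]
  refine Finset.sum_congr rfl fun t ht => ?_
  rcases U with _ | U
  · obtain rfl : t = 0 := Nat.lt_one_iff.1 (Finset.mem_range.1 ht)
    simp only [Nat.cast_zero, sub_self, zero_mul]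
  · have hle : t ≤ U + 1 := Finset.mem_range_succ_iff.1 ht
    have hchoose : (U.choose t : ℝ) * (U + 1 : ℕ) = (U + 1).choose t * ((U + 1 : ℕ) - t) := by
      rw [← Nat.cast_sub hle]
      exact_mod_cast Nat.choose_mul_succ_eq U t
    rw [Nat.add_sub_cancel]
    linear_combination f t * hchoose

theorem cornerPoint_succ (K N t : ℕ) :
    cornerPoint K N (t + 1) = (((N : ℝ) + t) / K,
      (((effectiveUsers K N).choose (t + 1) : ℝ) -
        ((effectiveUsers K N - N).choose (t + 1) : ℝ)) / ((effectiveUsers K N).choose t : ℝ)) := by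
  rw [cornerPoint, Nat.add_sub_cancel, Nat.cast_succ, ← add_assoc, add_sub_cancel_right]

/-- The size of the block of a sender for a set of `t` effective users when the schemes with
parameters `t` share each file in the proportions `w t`: a fraction `w t` of the file is split
evenly among the `K` senders and then among the `(U choose t)` sets of `t` effective users. -/
def blockSize (K N B : ℕ) (w : ℕ → ℝ) (t : ℕ) : ℕ :=
  ⌊w t * B / K / (effectiveUsers K N).choose t⌋₊

variable {K N : ℕ} (B : ℕ) {w : ℕ → ℝ}

theorem choose_mul_blockSize_le {t : ℕ} (hw : 0 ≤ w t) :
    ((effectiveUsers K N).choose t : ℝ) * blockSize K N B w t ≤ w t * B / K :=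
  calc _ ≤ ((effectiveUsers K N).choose t : ℝ) *
        (w t * B / K / (effectiveUsers K N).choose t) := by
        gcongr
        exact Nat.floor_le (by positivity)
    _ = w t * B / K * ((effectiveUsers K N).choose t / (effectiveUsers K N).choose t) :=
        mul_div_left_comm _ _ _
    _ ≤ w t * B / K := mul_le_of_le_one_right (by positivity) (div_self_le_one _)

theorem sub_choose_le_choose_mul_blockSize (w : ℕ → ℝ) {t : ℕ} (ht : t ≤ effectiveUsers K N) :
    w t * B / K - (effectiveUsers K N).choose t ≤
      ((effectiveUsers K N).choose t : ℝ) * blockSize K N B w t := by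
  have hC : (0 : ℝ) < (effectiveUsers K N).choose t := by exact_mod_cast Nat.choose_pos ht
  have hfloor := Nat.sub_one_lt_floor (w t * B / K / (effectiveUsers K N).choose t)
  have hmul := mul_le_mul_of_nonneg_left hfloor.le hC.le
  rwa [mul_sub, mul_div_cancel₀ _ hC.ne', mul_one] at hmul

section Weights

variable (hw : ∀ t ∈ Finset.range (effectiveUsers K N + 1), 0 ≤ w t)
include hw

theorem mul_sum_choose_mul_blockSize_le
    (hw_sum : ∑ t ∈ Finset.range (effectiveUsers K N + 1), w t = 1) :
    K * ∑ t ∈ Finset.range (effectiveUsers K N + 1),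
      (effectiveUsers K N).choose t * blockSize K N B w t ≤ B := by
  have hreal : (K : ℝ) * ∑ t ∈ Finset.range (effectiveUsers K N + 1),
      ((effectiveUsers K N).choose t : ℝ) * blockSize K N B w t ≤ B :=
    calc _ ≤ (K : ℝ) * ∑ t ∈ Finset.range (effectiveUsers K N + 1), w t * B / K := by
          gcongr with t ht
          exact choose_mul_blockSize_le B (hw t ht)
      _ = B * (K / K) := by
          rw [← Finset.sum_div, ← Finset.sum_mul, hw_sum, one_mul, mul_div_left_comm]
      _ ≤ B := mul_le_of_le_one_right (by positivity) (div_self_le_one _)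
  exact_mod_cast hreal

theorem mul_sum_blockSize_le_load :
    K * ∑ t ∈ Finset.range (effectiveUsers K N + 1), (((effectiveUsers K N).choose (t + 1) : ℝ) -
        ((effectiveUsers K N - N).choose (t + 1) : ℝ)) * blockSize K N B w t ≤
      B * (∑ t ∈ Finset.range (effectiveUsers K N + 1), w t • cornerPoint K N (t + 1)).2 := by
  rw [Prod.snd_sum, Finset.mul_sum, Finset.mul_sum]
  refine Finset.sum_le_sum fun t ht => ?_
  rw [cornerPoint_succ, Prod.smul_snd, smul_eq_mul]
  set C : ℝ := ((effectiveUsers K N).choose t : ℝ)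
  set c : ℝ := ((effectiveUsers K N).choose (t + 1) : ℝ) -
    ((effectiveUsers K N - N).choose (t + 1) : ℝ)
  have hc : 0 ≤ c := sub_nonneg.2 (by exact_mod_cast Nat.choose_le_choose _ (Nat.sub_le _ _))
  have hwt := hw t ht
  calc K * (c * blockSize K N B w t)
      ≤ K * (c * (w t * B / K / C)) := by
        gcongr
        exact Nat.floor_le (by positivity)
    _ = B * (K / K) * (w t * (c / C)) := by ring
    _ ≤ B * (w t * (c / C)) := by
        gcongr
        exact mul_le_of_le_one_right (by positivity) (div_self_le_one _)

end Weights

theorem mul_sub_sum_blockSize_le_memory (hK : 0 < K)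
    (hw_sum : ∑ t ∈ Finset.range (effectiveUsers K N + 1), w t = 1) :
    (N : ℝ) * (B - ((K - 1) * ∑ t ∈ Finset.range (effectiveUsers K N + 1),
        (effectiveUsers K N - 1).choose t * blockSize K N B w t : ℕ)) ≤
      B * (∑ t ∈ Finset.range (effectiveUsers K N + 1), w t • cornerPoint K N (t + 1)).1 +
        ∑ t ∈ Finset.range (effectiveUsers K N + 1),
          ((effectiveUsers K N : ℝ) - t) * (effectiveUsers K N).choose t := by
  have hK' : (K : ℝ) ≠ 0 := by exact_mod_cast hK.ne'
  have hU : (effectiveUsers K N : ℝ) = N * (K - 1 : ℕ) := by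
    rw [effectiveUsers, Nat.cast_mul, mul_comm]
  have hUK : (effectiveUsers K N : ℝ) = N * K - N := by
    rw [hU, Nat.cast_pred hK]
    ring
  set U := effectiveUsers K N
  have hsaved : (N : ℝ) * ((K - 1) * ∑ t ∈ Finset.range (U + 1),
      (U - 1).choose t * blockSize K N B w t : ℕ) =
      ∑ t ∈ Finset.range (U + 1), ((U : ℝ) - t) * (U.choose t * blockSize K N B w t) := by
    rw [← mul_sum_choose_pred_mul, hU]
    push_cast
    ring
  have hround : ∑ t ∈ Finset.range (U + 1), ((U : ℝ) - t) * (w t * B / K - U.choose t) ≤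
      ∑ t ∈ Finset.range (U + 1), ((U : ℝ) - t) * (U.choose t * blockSize K N B w t) := by
    refine Finset.sum_le_sum fun t ht => ?_
    have htU : t ≤ U := Finset.mem_range_succ_iff.1 ht
    exact mul_le_mul_of_nonneg_left (sub_choose_le_choose_mul_blockSize B w htU)
      (sub_nonneg.2 (by exact_mod_cast htU))
  have hmemory : B * (∑ t ∈ Finset.range (U + 1), w t • cornerPoint K N (t + 1)).1 =
      N * B - ∑ t ∈ Finset.range (U + 1), ((U : ℝ) - t) * (w t * B / K) := by
    rw [← one_mul ((N : ℝ) * B), ← hw_sum, Finset.sum_mul, ← Finset.sum_sub_distrib, Prod.fst_sum,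
      Finset.mul_sum]
    refine Finset.sum_congr rfl fun t _ => ?_
    rw [cornerPoint_succ, Prod.smul_fst, smul_eq_mul, hUK]
    field_simp
    ring
  simp only [mul_sub, Finset.sum_sub_distrib] at hround
  rw [mul_sub, hsaved, hmemory]
  simp only [sub_mul, Finset.sum_sub_distrib] at hround ⊢
  linarith

theorem achievable_sum_smul_cornerPoint [NeZero N] (hK : 2 ≤ K)
    (hw : ∀ t ∈ Finset.range (effectiveUsers K N + 1), 0 ≤ w t)
    (hw_sum : ∑ t ∈ Finset.range (effectiveUsers K N + 1), w t = 1) :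
    Achievable K N
      (∑ t ∈ Finset.range (effectiveUsers K N + 1), w t • cornerPoint K N (t + 1)).1
      (∑ t ∈ Finset.range (effectiveUsers K N + 1), w t • cornerPoint K N (t + 1)).2 := by
  let cacheSlack : ℝ := Real.logb 2 N + ∑ t ∈ Finset.range (effectiveUsers K N + 1),
    ((effectiveUsers K N : ℝ) - t) * (effectiveUsers K N).choose t
  let loadSlack : ℝ := K * (K * Real.logb 2 N)
  have hlog : 0 ≤ Real.logb 2 N :=
    Real.logb_nonneg one_lt_two (by exact_mod_cast NeZero.one_le)
  have hcacheSlack : 0 ≤ cacheSlack := by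
    refine add_nonneg hlog (Finset.sum_nonneg fun t ht => mul_nonneg (sub_nonneg.2 ?_) ?_)
    · exact_mod_cast Finset.mem_range_succ_iff.1 ht
    · positivity
  have hloadSlack : 0 ≤ loadSlack := by positivity
  refine ⟨fun B => (cacheSlack + loadSlack) / B, fun B => by positivity,
    tendsto_const_div_atTop_nhds_zero_nat _, ?_⟩
  filter_upwards [eventually_gt_atTop 0] with B hB
  have hslack : (B : ℝ) * ((cacheSlack + loadSlack) / B) = cacheSlack + loadSlack :=
    mul_div_cancel₀ _ (by exact_mod_cast hB.ne')
  obtain ⟨σ⟩ := Subpacketization.nonempty hB (mul_sum_choose_mul_blockSize_le B hw hw_sum)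
  refine ⟨σ.scheme, fun PD => ⟨fun k => ?_, fun k => ?_, σ.condMutualInfo_scheme PD, ?_⟩⟩
  · have hZ := σ.entropy_Z_le PD k
    have hmemory := mul_sub_sum_blockSize_le_memory B (by lia) hw_sum
    rw [mul_add, hslack]
    linarith
  · rw [σ.condEntropy_scheme PD k, hslack]
    positivity
  · have hX := Finset.sum_le_sum fun k (_ : k ∈ Finset.univ) => σ.entropy_X_le hK PD k
    have hload := mul_sum_blockSize_le_load B hw
    rw [Finset.sum_const, Finset.card_univ, Fintype.card_fin, nsmul_eq_mul, mul_add] at hX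
    rw [mul_add, hslack]
    linarith

end MemorySharing

/-! ### The lower convex envelope -/

theorem exists_weights_of_mem_convexHull_image {R E ι : Type*} [Field R] [LinearOrder R]
    [IsStrictOrderedRing R] [AddCommGroup E] [Module R E] {s : Finset ι} {z : ι → E} {x : E}
    (hx : x ∈ convexHull R (z '' s)) :
    ∃ w : ι → R, (∀ i ∈ s, 0 ≤ w i) ∧ ∑ i ∈ s, w i = 1 ∧ ∑ i ∈ s, w i • z i = x := by
  classical
  obtain ⟨κ, _, v, y, hv, hv_sum, hy, rfl⟩ := mem_convexHull_iff_exists_fintype.1 hx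
  choose g hg hgy using hy
  refine ⟨fun i => ∑ k with g k = i, v k, fun i _ => Finset.sum_nonneg fun k _ => hv k, ?_, ?_⟩
  · rw [Finset.sum_fiberwise_of_maps_to fun k _ => hg k, hv_sum]
  · rw [← Finset.sum_fiberwise_of_maps_to fun k _ => hg k]
    refine Finset.sum_congr rfl fun i _ => ?_
    rw [Finset.sum_smul]
    refine Finset.sum_congr rfl fun k hk => ?_
    rw [← hgy k, (Finset.mem_filter.1 hk).2]

theorem lowerConvexEnvelope_mem {S : Set (ℝ × ℝ)} (hS : IsCompact (convexHull ℝ S)) {x y : ℝ}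
    (hxy : (x, y) ∈ convexHull ℝ S) : (x, lowerConvexEnvelope S x) ∈ convexHull ℝ S := by
  have hfiber : IsCompact {y : ℝ | (x, y) ∈ convexHull ℝ S} :=
    (hS.image continuous_snd).of_isClosed_subset
      (hS.isClosed.preimage (Continuous.prodMk_right x)) fun y hy => ⟨(x, y), hy, rfl⟩
  exact hfiber.sInf_mem ⟨y, hxy⟩

theorem cornerPoints_eq_image (K N : ℕ) :
    cornerPoints K N =
      (fun t => cornerPoint K N (t + 1)) '' Finset.range (effectiveUsers K N + 1) := by
  ext p
  simp only [cornerPoints, Set.mem_image, Finset.coe_range, Set.mem_Iio]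
  constructor
  · rintro ⟨t, ht, htU, rfl⟩
    exact ⟨t - 1, by lia, by rw [Nat.sub_add_cancel ht]⟩
  · rintro ⟨t, ht, rfl⟩
    exact ⟨t + 1, by lia, by lia, rfl⟩

theorem isCompact_convexHull_cornerPoints (K N : ℕ) :
    IsCompact (convexHull ℝ (cornerPoints K N)) := by
  rw [cornerPoints_eq_image]
  exact ((Finset.finite_toSet _).image _).isCompact_convexHull (𝕜 := ℝ)

theorem exists_mem_convexHull_cornerPoints {K N : ℕ} (hK : 0 < K) {M : ℝ}
    (hM : M ∈ Set.Icc ((N : ℝ) / K) (N : ℝ)) :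
    ∃ R, (M, R) ∈ convexHull ℝ (cornerPoints K N) := by
  let first := cornerPoint K N 1
  let last := cornerPoint K N (effectiveUsers K N + 1)
  have hfirst : first.1 = (N : ℝ) / K := by
    simp only [first, cornerPoint, Nat.cast_one, add_sub_cancel_right]
  have hlast : last.1 = N := by
    have hK' : (K : ℝ) ≠ 0 := by exact_mod_cast hK.ne'
    simp only [last, cornerPoint, effectiveUsers]
    rw [div_eq_iff hK']
    push_cast [Nat.cast_pred hK]
    ring
  have hsegment : segment ℝ first last ⊆ convexHull ℝ (cornerPoints K N) :=
    (convex_convexHull ℝ _).segment_subset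
      (subset_convexHull ℝ _ ⟨1, le_rfl, Nat.le_add_left _ _, rfl⟩)
      (subset_convexHull ℝ _ ⟨_, Nat.le_add_left _ _, le_rfl, rfl⟩)
  rw [← segment_eq_Icc (hM.1.trans hM.2), ← hfirst, ← hlast] at hM
  obtain ⟨p, hp, rfl⟩ :=
    (image_segment ℝ (LinearMap.fst ℝ ℝ ℝ).toAffineMap first last).ge hM
  exact ⟨p.2, hsegment hp⟩

theorem achievable_of_mem_convexHull {K N : ℕ} [NeZero N] (hK : 2 ≤ K) {M R : ℝ}
    (h : (M, R) ∈ convexHull ℝ (cornerPoints K N)) : Achievable K N M R := by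
  rw [cornerPoints_eq_image] at h
  obtain ⟨w, hw, hw_sum, hMR⟩ := exists_weights_of_mem_convexHull_image h
  simpa only [hMR] using achievable_sum_smul_cornerPoint hK hw hw_sum

end D2DCaching

end

theorem theorem2 (K N : ℕ) (hK : 2 ≤ K) (hN : 2 ≤ N) (M : ℝ)
    (hM : M ∈ Set.Icc ((N : ℝ) / K) (N : ℝ)) :
    D2DCaching.Achievable K N M
        (D2DCaching.lowerConvexEnvelope (D2DCaching.cornerPoints K N) M) ∧
      D2DCaching.optimalLoad K N M ≤
        D2DCaching.lowerConvexEnvelope (D2DCaching.cornerPoints K N) M := by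
  have : NeZero N := ⟨by lia⟩
  obtain ⟨R, hR⟩ := D2DCaching.exists_mem_convexHull_cornerPoints (by lia) hM
  have hach := D2DCaching.achievable_of_mem_convexHull hK
    (D2DCaching.lowerConvexEnvelope_mem (D2DCaching.isCompact_convexHull_cornerPoints K N) hR)
  exact ⟨hach, csInf_le (D2DCaching.bddBelow_achievable (by lia) M) hach⟩
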